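/- Let $a_1,a_2,a_3,a_4,\alpha\in\mathbb C$ and put $A=\operatorname{Re}(a_1+a_2+a_3+a_4)$. For $n\in\mathbb Z$ let $$c_n=\frac{\alpha+n}{\prod_{j=1}^4\Gamma(a_j+\alpha+n)\,\Gamma(a_j-\alpha-n)},\qquad s_n=-i(\alpha+n),$$ be the summands of Dougall's bilateral ${}_5H_5$ formula (where $1/\Gamma$ is the entire function, equal to $0$ at the poles of $\Gamma$), and consider the discrete, in general sign-indefinite, weight $w_2$ that has mass $c_n$ at the point $s=s_n$ for each $n\in\mathbb Z$, i.e. $\int g\,w_2=\sum_{n\in\mathbb Z}c_n\,g(s_n)$ whenever this series converges absolutely. (If no $a_j\pm\alpha$ is an integer, then $c_n=\prod_{j=1}^4\frac{\sin\pi(a_j+\alpha)\,\sin\pi(a_j-\alpha)}{\pi^2}\cdot(is_n)\prod_{j=1}^4\Gamma(1-a_j-is_n)\Gamma(1-a_j+is_n)$.) Let $$p_n(a,b,c,d;s^2)=(a+b)_n(a+c)_n(a+d)_n\;{}_4F_3\!\left[{-n,\;n+a+b+c+d-1,\;a+is,\;a-is\atop a+b,\;a+c,\;a+d};1\right]$$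 be the Wilson polynomials, where $(x)_k=x(x+1)\cdots(x+k-1)$ and the right-hand side is read as the finite sum $$\sum_{j=0}^n\frac{(-n)_j(n+a+b+c+d-1)_j}{j!}(a+b+j)_{n-j}(a+c+j)_{n-j}(a+d+j)_{n-j}(a+is)_j(a-is)_j,$$ so that it makes sense for all parameters. Write $p_n(s^2)=p_n(1-a_1,1-a_2,1-a_3,1-a_4;s^2)$. Then the polynomials $p_n$ with $n\ge 0$ and $4n<A-3$ form a system of orthogonal polynomials for the weight $w_2$: $p_n$ has degree exactly $n$ in $s^2$, and for all $m,n\ge0$ with $4m<A-3$ and $4n<A-3$ the series $\sum_{k\in\mathbb Z}c_k\,p_m(s_k^2)\,p_n(s_k^2)$ converges absolutely, and for $m\ne n$ $$\sum_{k\in\mathbb Z}c_k\,p_m(s_k^2)\,p_n(s_k^2)=0 .$$ -/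

import Mathlib

/-- The Pochhammer symbol `(x)_k = x (x + 1) ⋯ (x + k - 1)`. -/
noncomputable def poch (x : ℂ) (k : ℕ) : ℂ := (ascPochhammer ℂ k).eval x

/-- The hypergeometric series `₄F₃[u₁, u₂, u₃, u₄; v₁, v₂, v₃; 1]`. -/
noncomputable def hyp4F3One (u₁ u₂ u₃ u₄ v₁ v₂ v₃ : ℂ) : ℂ :=
  ∑' k : ℕ, poch u₁ k * poch u₂ k * poch u₃ k * poch u₄ k /
    ((k.factorial : ℂ) * poch v₁ k * poch v₂ k * poch v₃ k)

/-- The Wilson polynomial `p_n(a, b, c, d; X)`, a polynomial in `X = s²`. It is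
`(a+b)_n (a+c)_n (a+d)_n ₄F₃[-n, n+a+b+c+d-1, a+is, a-is; a+b, a+c, a+d; 1]`
in which the quotients `(a+b)_n / (a+b)_j` are written `(a+b+j)_{n-j}` (and likewise for `c`, `d`),
so that it is defined for all parameters, and `(a+is)_j (a-is)_j = ∏_{i<j} ((a+i)² + s²)`;
see `wilsonPoly_eval_sq`. -/
noncomputable def wilsonPoly (a b c d : ℂ) (n : ℕ) : Polynomial ℂ :=
  ∑ j ∈ Finset.range (n + 1),
    Polynomial.C (poch (-(n : ℂ)) j * poch ((n : ℂ) + a + b + c + d - 1) j / (j.factorial : ℂ) *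
      (poch (a + b + j) (n - j) * poch (a + c + j) (n - j) * poch (a + d + j) (n - j))) *
    ∏ i ∈ Finset.range j, (Polynomial.X + Polynomial.C ((a + i) ^ 2))

/-- The summand of Dougall's bilateral `₅H₅` formula, as a function of `n`:
`(α + n) / ∏_j Γ(a_j + α + n) Γ(a_j - α - n)`. Here `1 / Γ` vanishes at the poles of `Γ`,
in agreement with `Complex.Gamma` being `0` there. -/
noncomputable def dougallCoeff (a : Fin 4 → ℂ) (α : ℂ) (n : ℤ) : ℂ :=
  (α + n) / ∏ j, (Complex.Gamma (a j + α + n) * Complex.Gamma (a j - α - n))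

/-- The point `s` with `i s = α + n` at which the `n`-th mass of the weight sits. -/
noncomputable def dougallNode (α : ℂ) (n : ℤ) : ℂ := -Complex.I * (α + n)

/-- `g` is (absolutely) integrable against the discrete weight with mass `dougallCoeff a α n`
at `s = dougallNode α n`, `n ∈ ℤ`. -/
def DougallIntegrable (a : Fin 4 → ℂ) (α : ℂ) (g : ℂ → ℂ) : Prop :=
  Summable fun n : ℤ => dougallCoeff a α n * g (dougallNode α n)

/-- The integral of `g` against the discrete weight with mass `dougallCoeff a α n`
at `s = dougallNode α n`, `n ∈ ℤ`. -/
noncomputable def dougallIntegral (a : Fin 4 → ℂ) (α : ℂ) (g : ℂ → ℂ) : ℂ :=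
  ∑' n : ℤ, dougallCoeff a α n * g (dougallNode α n)

theorem poch_eq_prod (x : ℂ) (k : ℕ) : poch x k = ∏ i ∈ Finset.range k, (x + i) := by
  induction k with
  | zero => simp [poch]
  | succ k ih =>
    rw [Finset.prod_range_succ, ← ih]
    simp [poch, ascPochhammer_succ_right]

theorem poch_split (x : ℂ) {j n : ℕ} (h : j ≤ n) :
    poch x n = poch x j * poch (x + j) (n - j) := by
  obtain ⟨m, rfl⟩ := Nat.exists_eq_add_of_le h
  simp only [poch_eq_prod, Finset.prod_range_add, Nat.add_sub_cancel_left]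
  congr 1
  exact Finset.prod_congr rfl fun i _ => by push_cast; ring

theorem poch_ne_zero_of_le {x : ℂ} {j n : ℕ} (h : j ≤ n) (hx : poch x n ≠ 0) : poch x j ≠ 0 := by
  rw [poch_split x h] at hx
  exact left_ne_zero_of_mul hx

/-- The classical definition of the Wilson polynomial, wherever its right-hand side makes sense. -/
theorem wilsonPoly_eval_sq (a b c d s : ℂ) (n : ℕ)
    (hb : poch (a + b) n ≠ 0) (hc : poch (a + c) n ≠ 0) (hd : poch (a + d) n ≠ 0) :
    (wilsonPoly a b c d n).eval (s ^ 2) =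
      poch (a + b) n * poch (a + c) n * poch (a + d) n *
        hyp4F3One (-(n : ℂ)) ((n : ℂ) + a + b + c + d - 1) (a + Complex.I * s) (a - Complex.I * s)
          (a + b) (a + c) (a + d) := by
  have hz : ∀ k ∉ Finset.range (n + 1), poch (-(n : ℂ)) k = 0 := by
    intro k hk
    rw [Finset.mem_range, not_lt] at hk
    rw [poch_eq_prod]
    exact Finset.prod_eq_zero (Finset.mem_range.mpr (show n < k by omega)) (by simp)
  rw [hyp4F3One, tsum_eq_sum (s := Finset.range (n + 1)) (fun k hk => by simp [hz k hk]),
    wilsonPoly, Polynomial.eval_finsetSum, Finset.mul_sum]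
  refine Finset.sum_congr rfl fun j hj => ?_
  have hj' : j ≤ n := by rw [Finset.mem_range] at hj; omega
  have h1 := poch_ne_zero_of_le hj' hb
  have h2 := poch_ne_zero_of_le hj' hc
  have h3 := poch_ne_zero_of_le hj' hd
  have hp : (∏ i ∈ Finset.range j, (Polynomial.X + Polynomial.C ((a + i) ^ 2))).eval (s ^ 2) =
      poch (a + Complex.I * s) j * poch (a - Complex.I * s) j := by
    rw [Polynomial.eval_prod, poch_eq_prod, poch_eq_prod, ← Finset.prod_mul_distrib]
    refine Finset.prod_congr rfl fun i _ => ?_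
    simp only [Polynomial.eval_add, Polynomial.eval_X, Polynomial.eval_C]
    linear_combination (s ^ 2) * Complex.I_sq
  have hf : (j.factorial : ℂ) ≠ 0 := by exact_mod_cast j.factorial_ne_zero
  rw [Polynomial.eval_mul, Polynomial.eval_C, hp, poch_split (a + b) hj', poch_split (a + c) hj',
    poch_split (a + d) hj']
  field_simp

/-- The form of the weight with the Gamma functions moved to the numerator. -/
theorem dougallCoeff_eq (a : Fin 4 → ℂ) (α : ℂ) (n : ℤ)
    (h₁ : ∀ j, Complex.sin (Real.pi * (a j + α)) ≠ 0)
    (h₂ : ∀ j, Complex.sin (Real.pi * (a j - α)) ≠ 0) :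
    dougallCoeff a α n =
      (∏ j, Complex.sin (Real.pi * (a j + α)) / Real.pi) *
      (∏ j, Complex.sin (Real.pi * (a j - α)) / Real.pi) * (α + n) *
      ∏ j, (Complex.Gamma (1 - a j - (α + n)) * Complex.Gamma (1 - a j + (α + n))) := by
  have hpi : (Real.pi : ℂ) ≠ 0 := by exact_mod_cast Real.pi_ne_zero
  have key : ∀ j, (Complex.Gamma (a j + α + n) * Complex.Gamma (a j - α - n))⁻¹ =
      (Complex.sin (Real.pi * (a j + α)) / Real.pi) *
      (Complex.sin (Real.pi * (a j - α)) / Real.pi) *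
      (Complex.Gamma (1 - a j - (α + n)) * Complex.Gamma (1 - a j + (α + n))) := by
    intro j
    have s1 : Complex.sin (Real.pi * (a j + α + n)) =
        (-1 : ℂ) ^ n * Complex.sin (Real.pi * (a j + α)) := by
      rw [← n.cast_negOnePow ℂ, ← Complex.sin_antiperiodic.add_int_mul_eq n]; congr 1; ring
    have s2 : Complex.sin (Real.pi * (a j - α - n)) =
        (-1 : ℂ) ^ n * Complex.sin (Real.pi * (a j - α)) := by
      rw [← n.cast_negOnePow ℂ, ← Complex.sin_antiperiodic.sub_int_mul_eq n]; congr 1; ring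
    have e : (-1 : ℂ) ^ n * (-1 : ℂ) ^ n = 1 := by
      rw [← mul_zpow]; simp
    have hne : (-1 : ℂ) ^ n ≠ 0 := zpow_ne_zero _ (by norm_num)
    have g1 := Complex.Gamma_mul_Gamma_one_sub (a j + α + n)
    have g2 := Complex.Gamma_mul_Gamma_one_sub (a j - α - n)
    rw [s1, show (1 : ℂ) - (a j + α + n) = 1 - a j - (α + n) by ring] at g1
    rw [s2, show (1 : ℂ) - (a j - α - n) = 1 - a j + (α + n) by ring] at g2
    rw [eq_div_iff (mul_ne_zero hne (h₁ j))] at g1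
    rw [eq_div_iff (mul_ne_zero hne (h₂ j))] at g2
    refine inv_eq_of_mul_eq_one_right ?_
    have h : Complex.Gamma (a j + α + n) * Complex.Gamma (1 - a j - (α + n)) *
        ((-1 : ℂ) ^ n * Complex.sin (Real.pi * (a j + α))) *
        (Complex.Gamma (a j - α - n) * Complex.Gamma (1 - a j + (α + n)) *
        ((-1 : ℂ) ^ n * Complex.sin (Real.pi * (a j - α)))) = Real.pi * Real.pi := by
      rw [g1, g2]
    generalize Complex.sin (Real.pi * (a j + α)) = S₁ at h ⊢
    generalize Complex.sin (Real.pi * (a j - α)) = S₂ at h ⊢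
    generalize Complex.Gamma (a j + α + n) = G₁ at h ⊢
    generalize Complex.Gamma (a j - α - n) = G₂ at h ⊢
    generalize Complex.Gamma (1 - a j - (α + n)) = G₃ at h ⊢
    generalize Complex.Gamma (1 - a j + (α + n)) = G₄ at h ⊢
    field_simp
    linear_combination h - G₁ * G₂ * S₁ * S₂ * G₃ * G₄ * e
  rw [dougallCoeff, div_eq_mul_inv, ← Finset.prod_inv_distrib, Finset.prod_congr rfl fun j _ => key j,
    Finset.prod_mul_distrib, Finset.prod_mul_distrib]
  ring

/-! Put `Y = α + n = is` and `b_j = 1 - a_j`. Wilson polynomials are even in `Y` and are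
eigenfunctions of a second-order difference operator, with eigenvalue `n (n + ∑ b_j - 1)`. The mass
is `Y R(Y)`, with `R` the reciprocal Gamma product. The functional equation of `Γ` gives `R(Y-1) ∏
(b_j+Y-1) = R(Y) ∏ (b_j-Y)`, which makes the operator formally symmetric for this weight.

For eigenfunctions `P`, `Q`, the Casoratian `P(Y+1) Q(Y) - P(Y) Q(Y+1)` equals `(2Y+1) V(Y)` with
`V` a polynomial. Then `2 (l-l') Y R P Q` is the backward difference of `R(Y) ∏ (b_j+Y) V(Y)`
(`lagrange_identity`, `recipGammaProd_sub_one`). Since `R` decays like `|n|^(4-2A)`, that function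
is summable over `ℤ`, so its differences sum to zero; finally `l ≠ l'`. -/

/-! ### Degree of the Wilson polynomials -/

open Polynomial in
theorem wilsonPoly_degree (b : Fin 4 → ℂ) (n : ℕ)
    (h : poch ((n : ℂ) + b 0 + b 1 + b 2 + b 3 - 1) n ≠ 0) :
    (wilsonPoly (b 0) (b 1) (b 2) (b 3) n).degree = n := by
  have hprod : ∀ j : ℕ, (∏ i ∈ Finset.range j, (X + C ((b 0 + i) ^ 2) : ℂ[X])).degree = j := by
    intro j
    rw [degree_prod, Finset.sum_congr rfl fun i _ => degree_X_add_C _]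
    simp
  have hneg : poch (-(n : ℂ)) n ≠ 0 := by
    rw [poch_eq_prod, Finset.prod_ne_zero_iff]
    intro i hi h0
    rw [Finset.mem_range] at hi
    have : (i : ℂ) = n := by linear_combination h0
    exact hi.ne (by exact_mod_cast this)
  -- Only the term `j = n` reaches degree `n`; the Pochhammer factors `(·)_{n-j}` in its coefficient
  -- are empty products.
  have htop : (C (poch (-(n : ℂ)) n * poch ((n : ℂ) + b 0 + b 1 + b 2 + b 3 - 1) n /
      (n.factorial : ℂ) * (poch (b 0 + b 1 + n) (n - n) * poch (b 0 + b 2 + n) (n - n) *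
      poch (b 0 + b 3 + n) (n - n))) * ∏ i ∈ Finset.range n, (X + C ((b 0 + i) ^ 2) : ℂ[X])).degree
      = n := by
    rw [degree_mul, degree_C, hprod, zero_add]
    have hf : (n.factorial : ℂ) ≠ 0 := by exact_mod_cast n.factorial_ne_zero
    simp only [Nat.sub_self]
    simp only [poch_eq_prod _ 0, Finset.range_zero, Finset.prod_empty, mul_one]
    exact div_ne_zero (mul_ne_zero hneg h) hf
  rw [wilsonPoly, Finset.sum_range_succ, add_comm, degree_add_eq_left_of_degree_lt]
  · exact htop
  · rw [htop, degree_lt_iff_coeff_zero]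
    intro k hk
    rw [finsetSum_coeff]
    refine Finset.sum_eq_zero fun j hj => ?_
    rw [coeff_C_mul, coeff_eq_zero_of_degree_lt, mul_zero]
    rw [hprod]
    exact_mod_cast (Finset.mem_range.mp hj).trans_le hk

/-! ### The difference equation -/

/-- The basis `(b + Y)_j (b - Y)_j` in which the Wilson polynomials are expanded. -/
noncomputable def wilsonBasis (b : ℂ) (j : ℕ) (Y : ℂ) : ℂ :=
  ∏ i ∈ Finset.range j, ((b + i) ^ 2 - Y ^ 2)

theorem wilsonBasis_succ (b : ℂ) (j : ℕ) (Y : ℂ) :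
    wilsonBasis b (j + 1) Y = wilsonBasis b j Y * ((b + j) ^ 2 - Y ^ 2) :=
  Finset.prod_range_succ _ _

theorem wilsonBasis_neg (b : ℂ) (j : ℕ) (Y : ℂ) : wilsonBasis b j (-Y) = wilsonBasis b j Y := by
  simp [wilsonBasis]

/-- The shift adds one end factor and drops the other in each of `(b+Y)_j` and `(b-Y)_j`. Clearing
denominators keeps this valid for every `Y`. -/
theorem wilsonBasis_shift (b : ℂ) (j : ℕ) (Y : ℂ) :
    (b + Y) * (b - Y + j - 1) * wilsonBasis b j (Y + 1) =
      (b + Y + j) * (b - Y - 1) * wilsonBasis b j Y := by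
  induction j with
  | zero => simp [wilsonBasis]
  | succ j ih =>
    rw [wilsonBasis_succ, wilsonBasis_succ]
    push_cast
    linear_combination (b - Y + j) * (b + Y + j + 1) * ih

theorem wilsonBasis_succ_shift_sub (b : ℂ) (j : ℕ) (Y : ℂ) :
    (b + Y) * (wilsonBasis b (j + 1) (Y + 1) - wilsonBasis b (j + 1) Y) =
      -((j : ℂ) + 1) * (2 * Y + 1) * (b + Y + j) * wilsonBasis b j Y := by
  rw [wilsonBasis_succ, wilsonBasis_succ]
  linear_combination (b + Y + j + 1) * wilsonBasis_shift b j Y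

theorem wilsonBasis_succ_shift_neg_sub (b : ℂ) (j : ℕ) (Y : ℂ) :
    (b - Y) * (wilsonBasis b (j + 1) (Y - 1) - wilsonBasis b (j + 1) Y) =
      ((j : ℂ) + 1) * (2 * Y - 1) * (b - Y + j) * wilsonBasis b j Y := by
  have h := wilsonBasis_succ_shift_sub b j (-Y)
  rw [show -Y + 1 = -(Y - 1) by ring] at h
  simp only [wilsonBasis_neg] at h
  linear_combination h

/-- The Wilson difference operator multiplied by `2 Y (2 Y + 1) (2 Y - 1)`. -/
noncomputable def wilsonOp (b : Fin 4 → ℂ) (f : ℂ → ℂ) (Y : ℂ) : ℂ :=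
  (2 * Y - 1) * (∏ k, (b k + Y)) * (f (Y + 1) - f Y) +
    (2 * Y + 1) * (∏ k, (b k - Y)) * (f (Y - 1) - f Y)

/-- The operator is bidiagonal in this basis, so the eigenvalue equation becomes the two-term
recurrence `wilsonCoeff_succ`. -/
theorem wilsonOp_basis_succ (b : Fin 4 → ℂ) (j : ℕ) (Y : ℂ) :
    wilsonOp b (wilsonBasis (b 0) (j + 1)) Y = 2 * Y * (2 * Y + 1) * (2 * Y - 1) *
      (((j : ℂ) + 1) * (j + b 0 + b 1 + b 2 + b 3) * wilsonBasis (b 0) (j + 1) Y -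
        (j + 1) * ((b 0 + b 1 + j) * (b 0 + b 2 + j) * (b 0 + b 3 + j)) * wilsonBasis (b 0) j Y) := by
  simp only [wilsonOp, Fin.prod_univ_four]
  have h1 := wilsonBasis_succ_shift_sub (b 0) j Y
  have h2 := wilsonBasis_succ_shift_neg_sub (b 0) j Y
  have h3 := wilsonBasis_succ (b 0) j Y
  linear_combination (2 * Y - 1) * (b 1 + Y) * (b 2 + Y) * (b 3 + Y) * h1 +
    (2 * Y + 1) * (b 1 - Y) * (b 2 - Y) * (b 3 - Y) * h2 -
    2 * Y * (2 * Y + 1) * (2 * Y - 1) * (((j : ℂ) + 1) * (j + b 0 + b 1 + b 2 + b 3)) * h3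

theorem wilsonOp_basis_zero (b : Fin 4 → ℂ) (Y : ℂ) :
    wilsonOp b (wilsonBasis (b 0) 0) Y = 0 := by
  simp [wilsonOp, wilsonBasis]

/-- The coefficients of the Wilson polynomial in the basis `wilsonBasis`. -/
noncomputable def wilsonCoeff (b : Fin 4 → ℂ) (n j : ℕ) : ℂ :=
  poch (-(n : ℂ)) j * poch ((n : ℂ) + b 0 + b 1 + b 2 + b 3 - 1) j / (j.factorial : ℂ) *
    (poch (b 0 + b 1 + j) (n - j) * poch (b 0 + b 2 + j) (n - j) * poch (b 0 + b 3 + j) (n - j))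

theorem wilsonPoly_eval_neg_sq (b : Fin 4 → ℂ) (n : ℕ) (Y : ℂ) :
    (wilsonPoly (b 0) (b 1) (b 2) (b 3) n).eval (-Y ^ 2) =
      ∑ j ∈ Finset.range (n + 1), wilsonCoeff b n j * wilsonBasis (b 0) j Y := by
  rw [wilsonPoly, Polynomial.eval_finsetSum]
  refine Finset.sum_congr rfl fun j _ => ?_
  rw [Polynomial.eval_mul, Polynomial.eval_C, Polynomial.eval_prod, wilsonCoeff, wilsonBasis]
  congr 1
  refine Finset.prod_congr rfl fun i _ => ?_
  simp only [Polynomial.eval_add, Polynomial.eval_X, Polynomial.eval_C]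
  ring

theorem poch_succ (x : ℂ) (k : ℕ) : poch x (k + 1) = poch x k * (x + k) := by
  simp only [poch_eq_prod, Finset.prod_range_succ]

theorem poch_succ_left (x : ℂ) (k : ℕ) : poch x (k + 1) = x * poch (x + 1) k := by
  rw [poch_split x (Nat.le_add_left 1 k), Nat.add_sub_cancel]
  simp [poch_eq_prod x 1]

theorem wilsonCoeff_succ (b : Fin 4 → ℂ) {n j : ℕ} (h : j < n) :
    ((j : ℂ) + 1) * ((b 0 + b 1 + j) * (b 0 + b 2 + j) * (b 0 + b 3 + j)) * wilsonCoeff b n (j + 1) =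
      ((j : ℂ) - n) * (n + b 0 + b 1 + b 2 + b 3 - 1 + j) * wilsonCoeff b n j := by
  obtain ⟨m, rfl⟩ := Nat.exists_eq_add_of_lt h
  have e1 : j + m + 1 - j = m + 1 := by omega
  have e2 : j + m + 1 - (j + 1) = m := by omega
  simp only [wilsonCoeff, e1, e2, poch_succ _ j, poch_succ_left _ m, Nat.factorial_succ]
  have hf : (j.factorial : ℂ) ≠ 0 := by exact_mod_cast j.factorial_ne_zero
  have hj : (j : ℂ) + 1 ≠ 0 := by exact_mod_cast j.succ_ne_zero
  push_cast
  simp only [add_assoc]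
  field_simp
  ring

theorem wilsonOp_sum (b : Fin 4 → ℂ) (s : Finset ℕ) (c : ℕ → ℂ) (f : ℕ → ℂ → ℂ) (Y : ℂ) :
    wilsonOp b (fun y => ∑ j ∈ s, c j * f j y) Y = ∑ j ∈ s, c j * wilsonOp b (f j) Y := by
  simp only [wilsonOp, ← Finset.sum_sub_distrib, Finset.mul_sum, ← Finset.sum_add_distrib]
  exact Finset.sum_congr rfl fun j _ => by ring

/-- The difference equation of the Wilson polynomials, cleared of denominators. -/
theorem wilsonOp_wilsonPoly (b : Fin 4 → ℂ) (n : ℕ) (Y : ℂ) :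
    wilsonOp b (fun y => (wilsonPoly (b 0) (b 1) (b 2) (b 3) n).eval (-y ^ 2)) Y =
      2 * Y * (2 * Y + 1) * (2 * Y - 1) * (n * (n + b 0 + b 1 + b 2 + b 3 - 1)) *
        (wilsonPoly (b 0) (b 1) (b 2) (b 3) n).eval (-Y ^ 2) := by
  simp only [wilsonPoly_eval_neg_sq, wilsonOp_sum]
  -- Truncating the sum at `k` leaves one boundary term, whose factor `k - n` vanishes at `k = n`.
  have key : ∀ k ≤ n, ∑ j ∈ Finset.range (k + 1), wilsonCoeff b n j *
      wilsonOp b (wilsonBasis (b 0) j) Y = 2 * Y * (2 * Y + 1) * (2 * Y - 1) *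
      ((n * (n + b 0 + b 1 + b 2 + b 3 - 1)) *
        (∑ j ∈ Finset.range (k + 1), wilsonCoeff b n j * wilsonBasis (b 0) j Y) +
        ((k : ℂ) - n) * (n + b 0 + b 1 + b 2 + b 3 - 1 + k) * wilsonCoeff b n k *
          wilsonBasis (b 0) k Y) := by
    intro k
    induction k with
    | zero =>
      intro _
      simp [wilsonOp_basis_zero]
      right
      ring
    | succ k ih =>
      intro hk
      have h := wilsonCoeff_succ b (n := n) (j := k) hk
      rw [Finset.sum_range_succ, ih (by omega), Finset.sum_range_succ _ (k + 1),
        wilsonOp_basis_succ]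
      push_cast
      linear_combination -(2 * Y * (2 * Y + 1) * (2 * Y - 1) * wilsonBasis (b 0) k Y) * h
  rw [key n le_rfl]
  ring

/-! ### Summation by parts -/

open Polynomial in
/-- The Casoratian of two even functions vanishes at `-1/2`, which removes the pole of the
summed-by-parts weight. -/
theorem exists_casoratian_factor (P Q : Polynomial ℂ) (hP : ∀ Y, P.eval (-Y) = P.eval Y)
    (hQ : ∀ Y, Q.eval (-Y) = Q.eval Y) :
    ∃ V : Polynomial ℂ, V.natDegree ≤ P.natDegree + Q.natDegree ∧
      ∀ Y, P.eval (Y + 1) * Q.eval Y - P.eval Y * Q.eval (Y + 1) = (2 * Y + 1) * V.eval Y := by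
  set W : ℂ[X] := P.comp (X + C 1) * Q - P * Q.comp (X + C 1) with hW
  have hWe : ∀ Y, W.eval Y = P.eval (Y + 1) * Q.eval Y - P.eval Y * Q.eval (Y + 1) := by
    intro Y; simp [hW]
  have hroot : W.IsRoot (-(1 / 2)) := by
    rw [IsRoot, hWe, hP, hQ]
    norm_num
  obtain ⟨T, hT⟩ := dvd_iff_isRoot.mpr hroot
  have hcomp : ∀ R : ℂ[X], (R.comp (X + C 1)).natDegree = R.natDegree := by
    intro R
    rw [natDegree_comp, natDegree_X_add_C, mul_one]
  refine ⟨C (1 / 2) * T, ?_, fun Y => ?_⟩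
  · have h1 : W.natDegree ≤ P.natDegree + Q.natDegree := by
      refine (natDegree_sub_le _ _).trans (max_le ?_ ?_)
      · exact natDegree_mul_le.trans (by rw [hcomp])
      · exact natDegree_mul_le.trans (by rw [hcomp])
    have h2 : (C (1 / 2 : ℂ) * T).natDegree ≤ T.natDegree := natDegree_C_mul_le _ _
    by_cases hT0 : T = 0
    · simp [hT0]
    · have h3 : W.natDegree = 1 + T.natDegree := by
        rw [hT, natDegree_mul (X_sub_C_ne_zero _) hT0, natDegree_X_sub_C]
      omega
  · rw [← hWe, hT]
    simp only [eval_mul, eval_sub, eval_X, eval_C]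
    ring

open Polynomial in
/-- The pole-free Lagrange identity for two polynomial eigenfunctions of the Wilson operator. -/
theorem lagrange_identity (b : Fin 4 → ℂ) (P Q V : Polynomial ℂ) (l l' : ℂ)
    (hP : ∀ Y, wilsonOp b (fun y => P.eval y) Y =
      2 * Y * (2 * Y + 1) * (2 * Y - 1) * l * P.eval Y)
    (hQ : ∀ Y, wilsonOp b (fun y => Q.eval y) Y =
      2 * Y * (2 * Y + 1) * (2 * Y - 1) * l' * Q.eval Y)
    (hV : ∀ Y, P.eval (Y + 1) * Q.eval Y - P.eval Y * Q.eval (Y + 1) = (2 * Y + 1) * V.eval Y)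
    (Y : ℂ) :
    2 * Y * (l - l') * (P.eval Y * Q.eval Y) =
      (∏ k, (b k + Y)) * V.eval Y - (∏ k, (b k - Y)) * V.eval (Y - 1) := by
  -- Cancelling `(2Y+1)(2Y-1)` between polynomials, not values, keeps the identity at `Y = ±1/2`,
  -- which may be nodes.
  have hpoly : (C 2 * X + C 1) * (C 2 * X - C 1) * (C 2 * X * C (l - l') * (P * Q)) =
      (C 2 * X + C 1) * (C 2 * X - C 1) *
        ((∏ k, (C (b k) + X)) * V - (∏ k, (C (b k) - X)) * V.comp (X - C 1)) := by
    refine Polynomial.funext fun y => ?_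
    have h1 := hP y
    have h2 := hQ y
    have h3 := hV y
    have h4 := hV (y - 1)
    rw [sub_add_cancel] at h4
    simp only [wilsonOp] at h1 h2
    simp only [eval_mul, eval_add, eval_sub, eval_comp, eval_prod, eval_X, eval_C]
    linear_combination -Q.eval y * h1 + P.eval y * h2 + (2 * y - 1) * (∏ k, (b k + y)) * h3 -
      (2 * y + 1) * (∏ k, (b k - y)) * h4
  have hne : ∀ c : ℂ, (C 2 * X + C c : ℂ[X]) ≠ 0 := by
    intro c h0
    have := congrArg (coeff · 1) h0
    simp at this
  have hne' : (C 2 * X - C 1 : ℂ[X]) ≠ 0 := by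
    have := hne (-1)
    rwa [C_neg, ← sub_eq_add_neg] at this
  have h := congrArg (eval Y) (mul_left_cancel₀ (mul_ne_zero (hne 1) hne') hpoly)
  simpa only [eval_mul, eval_add, eval_sub, eval_comp, eval_prod, eval_X, eval_C] using h

/-! ### The weight and its first-order recurrence -/

/-- The reciprocal Gamma product in Dougall's summand, as an entire function of `Y = α + n`. -/
noncomputable def recipGammaProd (a : Fin 4 → ℂ) (Y : ℂ) : ℂ :=
  ∏ j, ((Complex.Gamma (a j + Y))⁻¹ * (Complex.Gamma (a j - Y))⁻¹)

theorem inv_Gamma_eq (z : ℂ) : (Complex.Gamma z)⁻¹ = z * (Complex.Gamma (z + 1))⁻¹ :=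
  Complex.one_div_Gamma_eq_self_mul_one_div_Gamma_add_one z

theorem recipGammaProd_neg (a : Fin 4 → ℂ) (Y : ℂ) :
    recipGammaProd a (-Y) = recipGammaProd a Y := by
  refine Finset.prod_congr rfl fun j _ => ?_
  rw [sub_neg_eq_add, ← sub_eq_add_neg, mul_comm]

theorem recipGammaProd_sub_one (a : Fin 4 → ℂ) (Y : ℂ) :
    recipGammaProd a (Y - 1) * ∏ j, (1 - a j + (Y - 1)) =
      recipGammaProd a Y * ∏ j, (1 - a j - Y) := by
  simp only [recipGammaProd, ← Finset.prod_mul_distrib]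
  refine Finset.prod_congr rfl fun j _ => ?_
  rw [inv_Gamma_eq (a j + (Y - 1)), inv_Gamma_eq (a j - Y),
    show a j + (Y - 1) + 1 = a j + Y by ring, show a j - Y + 1 = a j - (Y - 1) by ring]
  ring

theorem dougallCoeff_eq_recipGammaProd (a : Fin 4 → ℂ) (α : ℂ) (n : ℤ) :
    dougallCoeff a α n = (α + n) * recipGammaProd a (α + n) := by
  simp only [dougallCoeff, recipGammaProd, div_eq_mul_inv, ← Finset.prod_inv_distrib, mul_inv,
    add_assoc, sub_sub]

theorem dougallNode_sq (α : ℂ) (n : ℤ) : dougallNode α n ^ 2 = -(α + n) ^ 2 := by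
  rw [dougallNode, mul_pow, neg_sq, Complex.I_sq]
  ring

/-! ### Growth of the weight and summability -/

open Filter Asymptotics

theorem add_nat_isBigO (α : ℂ) : (fun n : ℕ => α + n) =O[atTop] fun n : ℕ => (n : ℝ) := by
  refine IsBigO.add (IsBigO.of_bound ‖α‖ ?_)
    (IsBigO.of_bound 1 (Eventually.of_forall fun n => by simp))
  filter_upwards [eventually_ge_atTop 1] with n hn
  have : (1 : ℝ) ≤ n := by exact_mod_cast hn
  rw [Real.norm_of_nonneg (by positivity)]
  exact le_mul_of_one_le_right (norm_nonneg _) this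

theorem poch_isBigO (z : ℂ) : (fun n : ℕ => poch z (n + 1)) =O[atTop]
    fun n : ℕ => (n : ℝ) ^ z.re * n.factorial := by
  -- At a pole `z = -m` Euler's limit cannot be inverted, but `(z)_{n+1}` is then eventually zero.
  by_cases hz : Complex.Gamma z = 0
  · obtain ⟨m, hm⟩ := (Complex.Gamma_eq_zero_iff z).mp hz
    refine IsBigO.of_bound 1 ?_
    filter_upwards [eventually_ge_atTop m] with n hn
    rw [poch_eq_prod, Finset.prod_eq_zero (i := m) (Finset.mem_range.mpr (by omega)) (by simp [hm]),
      norm_zero]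
    positivity
  · have h1 := ((Complex.GammaSeq_tendsto_Gamma z).inv₀ hz).isBigO_one ℝ
    have h2 : (fun n : ℕ => (n : ℂ) ^ z * n.factorial) =O[atTop]
        fun n : ℕ => (n : ℝ) ^ z.re * n.factorial := by
      refine IsBigO.of_bound 1 ?_
      filter_upwards [eventually_gt_atTop 0] with n hn
      rw [norm_mul, norm_mul, Complex.norm_natCast_cpow_of_pos hn,
        Real.norm_of_nonneg (by positivity : (0 : ℝ) ≤ (n : ℝ) ^ z.re)]
      simp
    refine ((h2.mul h1).congr_right fun n => mul_one _).congr' ?_ (EventuallyEq.refl _ _)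
    filter_upwards [eventually_gt_atTop 0] with n hn
    have hn' : (n : ℂ) ^ z ≠ 0 := by
      rw [Ne, Complex.cpow_eq_zero_iff]
      exact fun h => hn.ne' (by exact_mod_cast h.1)
    have hf : (n.factorial : ℂ) ≠ 0 := by exact_mod_cast n.factorial_ne_zero
    rw [Complex.GammaSeq, ← poch_eq_prod, inv_div, mul_div_cancel₀ _ (mul_ne_zero hn' hf)]

theorem Gamma_add_nat_eq_poch (w : ℂ) (hw : 0 < w.re) (n : ℕ) :
    Complex.Gamma (w + n) = poch w n * Complex.Gamma w := by
  induction n with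
  | zero => simp [poch_eq_prod]
  | succ n ih =>
    have h0 : w + n ≠ 0 := by
      intro h
      have h1 := congrArg Complex.re h
      simp at h1
      linarith [(Nat.cast_nonneg n : (0 : ℝ) ≤ n)]
    rw [poch_succ, Nat.cast_succ, ← add_assoc, Complex.Gamma_add_one _ h0, ih]
    ring

theorem inv_Gamma_add_nat_isBigO (z : ℂ) : (fun n : ℕ => (Complex.Gamma (z + n))⁻¹) =O[atTop]
    fun n : ℕ => (n : ℝ) ^ (1 - z.re) * (n.factorial : ℝ)⁻¹ := by
  obtain ⟨k, hk⟩ := exists_nat_gt (1 - z.re)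
  -- The functional equation moves `z` to the right until `Re z > 1`; then `Γ(z+n) = (z-1)_{n+1}
  -- Γ(z-1)` matches Euler's sequence at `z-1`.
  induction k generalizing z with
  | zero =>
    have hw : 0 < (z - 1).re := by simp at hk ⊢; linarith
    have h1 := (Complex.GammaSeq_tendsto_Gamma (z - 1)).isBigO_one ℝ
    have h2 : (fun n : ℕ => ((n : ℂ) ^ (z - 1) * n.factorial * Complex.Gamma (z - 1))⁻¹) =O[atTop]
        fun n : ℕ => (n : ℝ) ^ (1 - z.re) * (n.factorial : ℝ)⁻¹ := by
      refine IsBigO.of_bound ‖(Complex.Gamma (z - 1))⁻¹‖ ?_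
      filter_upwards [eventually_gt_atTop 0] with n hn
      rw [norm_inv, norm_mul, norm_mul, Complex.norm_natCast_cpow_of_pos hn, norm_mul,
        Real.norm_of_nonneg (by positivity : (0 : ℝ) ≤ (n : ℝ) ^ (1 - z.re)),
        show 1 - z.re = -(z - 1).re by simp, Real.rpow_neg (Nat.cast_nonneg n)]
      simp [mul_comm]
    refine ((h2.mul h1).congr_right fun n => mul_one _).congr' ?_ (EventuallyEq.refl _ _)
    filter_upwards [eventually_gt_atTop 0] with n hn
    have hn' : (n : ℂ) ^ (z - 1) ≠ 0 := by
      rw [Ne, Complex.cpow_eq_zero_iff]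
      exact fun h => hn.ne' (by exact_mod_cast h.1)
    have hf : (n.factorial : ℂ) ≠ 0 := by exact_mod_cast n.factorial_ne_zero
    have hG := Gamma_add_nat_eq_poch (z - 1) hw (n + 1)
    rw [show z - 1 + ((n + 1 : ℕ) : ℂ) = z + n by push_cast; ring] at hG
    rw [hG, Complex.GammaSeq, ← poch_eq_prod]
    field_simp
  | succ k ih =>
    have h1 := (add_nat_isBigO z).mul (ih (z + 1) (by push_cast at hk; simp; linarith))
    refine (h1.congr_left fun n => ?_).congr' (EventuallyEq.refl _ _) ?_
    · rw [inv_Gamma_eq (z + n), add_right_comm]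
    · filter_upwards [eventually_gt_atTop 0] with n hn
      have hn' : (0 : ℝ) < n := by exact_mod_cast hn
      rw [show 1 - z.re = 1 + (1 - (z + 1).re) by simp; ring, Real.rpow_add hn', Real.rpow_one, mul_assoc]

theorem inv_Gamma_sub_nat (z : ℂ) (n : ℕ) : (Complex.Gamma (z - n))⁻¹ =
    (-1) ^ (n + 1) * poch (-z) (n + 1) * (Complex.Gamma (z + 1))⁻¹ := by
  induction n with
  | zero =>
    rw [inv_Gamma_eq (z - (0 : ℕ)), poch_eq_prod]
    simp
  | succ n ih =>
    rw [inv_Gamma_eq, show z - (n + 1 : ℕ) + 1 = z - n by push_cast; ring, ih, poch_succ _ (n + 1)]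
    push_cast
    ring

/-- One factor decays like `1/n!` and the other grows at most like `n!`, up to powers of `n`; the
factorials and the contributions of `α` to the exponent cancel. -/
theorem inv_Gamma_mul_inv_Gamma_isBigO (a α : ℂ) :
    (fun n : ℕ => (Complex.Gamma (a + (α + n)))⁻¹ * (Complex.Gamma (a - (α + n)))⁻¹) =O[atTop]
      fun n : ℕ => (n : ℝ) ^ (1 - 2 * a.re) := by
  have h1 := inv_Gamma_add_nat_isBigO (a + α)
  have h2 : (fun n : ℕ => (Complex.Gamma (a - α - n))⁻¹) =O[atTop]
      fun n : ℕ => (n : ℝ) ^ (-(a - α)).re * n.factorial := by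
    refine IsBigO.trans (IsBigO.of_bound ‖(Complex.Gamma (a - α + 1))⁻¹‖ ?_)
      (poch_isBigO (-(a - α)))
    refine Eventually.of_forall fun n => ?_
    rw [inv_Gamma_sub_nat, norm_mul, norm_mul]
    simp [mul_comm]
  refine ((h1.mul h2).congr_left fun n => ?_).congr' (EventuallyEq.refl _ _) ?_
  · rw [add_assoc, sub_sub]
  · filter_upwards [eventually_gt_atTop 0] with n hn
    have hn' : (0 : ℝ) < n := by exact_mod_cast hn
    have hf : (n.factorial : ℝ) ≠ 0 := by exact_mod_cast n.factorial_ne_zero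
    rw [show 1 - 2 * a.re = (1 - (a + α).re) + (-(a - α)).re by simp; ring,
      Real.rpow_add hn']
    field_simp

theorem recipGammaProd_isBigO (a : Fin 4 → ℂ) (α : ℂ) :
    (fun n : ℕ => recipGammaProd a (α + n)) =O[atTop]
      fun n : ℕ => (n : ℝ) ^ (4 - 2 * (a 0 + a 1 + a 2 + a 3).re) := by
  have h := ((((inv_Gamma_mul_inv_Gamma_isBigO (a 0) α).mul
    (inv_Gamma_mul_inv_Gamma_isBigO (a 1) α)).mul
    (inv_Gamma_mul_inv_Gamma_isBigO (a 2) α)).mul (inv_Gamma_mul_inv_Gamma_isBigO (a 3) α))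
  refine (h.congr_left fun n => ?_).congr' (EventuallyEq.refl _ _) ?_
  · rw [recipGammaProd, Fin.prod_univ_four]
  · filter_upwards [eventually_gt_atTop 0] with n hn
    have hn' : (0 : ℝ) < n := by exact_mod_cast hn
    rw [← Real.rpow_add hn', ← Real.rpow_add hn', ← Real.rpow_add hn']
    congr 1
    simp
    ring

theorem polynomial_eval_add_nat_isBigO (P : Polynomial ℂ) (α : ℂ) :
    (fun n : ℕ => P.eval (α + n)) =O[atTop] fun n : ℕ => (n : ℝ) ^ (P.natDegree : ℝ) := by
  simp only [Polynomial.eval_eq_sum_range]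
  have hmono : ∀ i ∈ Finset.range (P.natDegree + 1),
      (fun n : ℕ => P.coeff i * (α + n) ^ i) =O[atTop] fun n : ℕ => (n : ℝ) ^ (P.natDegree : ℝ) := by
    intro i hi
    refine IsBigO.const_mul_left ?_ _
    refine IsBigO.trans ((add_nat_isBigO α).pow i) ?_
    refine IsBigO.of_bound 1 ?_
    filter_upwards [eventually_ge_atTop 1] with n hn
    have hn' : (1 : ℝ) ≤ n := by exact_mod_cast hn
    rw [one_mul, Real.rpow_natCast, norm_pow, norm_pow, Real.norm_of_nonneg (by positivity)]
    exact pow_le_pow_right₀ hn' (by rw [Finset.mem_range] at hi; omega)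
  exact IsBigO.fun_sum hmono

theorem summable_nat_recipGammaProd_mul_eval (a : Fin 4 → ℂ) (α : ℂ) (P : Polynomial ℂ)
    (h : 5 + (P.natDegree : ℝ) < 2 * (a 0 + a 1 + a 2 + a 3).re) :
    Summable fun n : ℕ => recipGammaProd a (α + n) * P.eval (α + n) := by
  have h1 := (recipGammaProd_isBigO a α).mul (polynomial_eval_add_nat_isBigO P α)
  refine summable_of_isBigO_nat (g := fun n : ℕ =>
    (n : ℝ) ^ (4 - 2 * (a 0 + a 1 + a 2 + a 3).re + P.natDegree)) ?_ (h1.congr' (EventuallyEq.refl _ _) ?_)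
  · exact Real.summable_nat_rpow.mpr (by linarith)
  · filter_upwards [eventually_gt_atTop 0] with n hn
    rw [Real.rpow_add (by exact_mod_cast hn)]

open Polynomial in
theorem summable_recipGammaProd_mul_eval (a : Fin 4 → ℂ) (α : ℂ) (P : Polynomial ℂ)
    (h : 5 + (P.natDegree : ℝ) < 2 * (a 0 + a 1 + a 2 + a 3).re) :
    Summable fun n : ℤ => recipGammaProd a (α + n) * P.eval (α + n) := by
  refine Summable.of_nat_of_neg ?_ ?_
  · simpa using summable_nat_recipGammaProd_mul_eval a α P h
  -- As `R` is even, the negative half is a positive half with `α` and `X` negated.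
  · have hd : (P.comp (-X)).natDegree = P.natDegree := by simp [natDegree_comp]
    refine (summable_nat_recipGammaProd_mul_eval a (-α) (P.comp (-X)) (by rwa [hd])).congr
      fun n => ?_
    rw [← recipGammaProd_neg]
    simp [neg_add_eq_sub, sub_eq_add_neg]

/-! ### Orthogonality -/

open Polynomial in
theorem mainTheorem8 (a : Fin 4 → ℂ) (α : ℂ) :
    (∀ n : ℕ, 4 * (n : ℝ) < (a 0 + a 1 + a 2 + a 3).re - 3 →
      (wilsonPoly (1 - a 0) (1 - a 1) (1 - a 2) (1 - a 3) n).degree = n) ∧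
    (∀ m n : ℕ, 4 * (m : ℝ) < (a 0 + a 1 + a 2 + a 3).re - 3 →
      4 * (n : ℝ) < (a 0 + a 1 + a 2 + a 3).re - 3 →
      DougallIntegrable a α (fun s =>
        (wilsonPoly (1 - a 0) (1 - a 1) (1 - a 2) (1 - a 3) m).eval (s ^ 2) *
        (wilsonPoly (1 - a 0) (1 - a 1) (1 - a 2) (1 - a 3) n).eval (s ^ 2)) ∧
      (m ≠ n →
        dougallIntegral a α (fun s =>
          (wilsonPoly (1 - a 0) (1 - a 1) (1 - a 2) (1 - a 3) m).eval (s ^ 2) *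
          (wilsonPoly (1 - a 0) (1 - a 1) (1 - a 2) (1 - a 3) n).eval (s ^ 2)) = 0)) := by
  have hdeg : ∀ n : ℕ, 4 * (n : ℝ) < (a 0 + a 1 + a 2 + a 3).re - 3 →
      (wilsonPoly (1 - a 0) (1 - a 1) (1 - a 2) (1 - a 3) n).degree = n := by
    intro n hn
    refine wilsonPoly_degree (fun j => 1 - a j) n ?_
    rw [poch_eq_prod, Finset.prod_ne_zero_iff]
    intro i hi h0
    -- The factor has real part `n + 3 - A + i < 2n + 3 - A < 0`.
    have hi' : (i : ℝ) < n := by exact_mod_cast Finset.mem_range.mp hi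
    have h1 := congrArg Complex.re h0
    simp at h1 hn
    linarith [(Nat.cast_nonneg i : (0 : ℝ) ≤ i)]
  refine ⟨hdeg, fun m n hm hn => ?_⟩
  set P : ℕ → ℂ[X] := fun k => (wilsonPoly (1 - a 0) (1 - a 1) (1 - a 2) (1 - a 3) k).comp (-X ^ 2)
    with hPdef
  have hPe : ∀ k Y, (P k).eval Y =
      (wilsonPoly (1 - a 0) (1 - a 1) (1 - a 2) (1 - a 3) k).eval (-Y ^ 2) := by
    intro k Y; simp [hPdef]
  have hPd : ∀ k : ℕ, 4 * (k : ℝ) < (a 0 + a 1 + a 2 + a 3).re - 3 →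
      (P k).natDegree = k * 2 := by
    intro k hk
    rw [hPdef, natDegree_comp, natDegree_eq_of_degree_eq_some (hdeg k hk)]
    simp
  have hterm : ∀ k : ℤ, dougallCoeff a α k *
      ((wilsonPoly (1 - a 0) (1 - a 1) (1 - a 2) (1 - a 3) m).eval (dougallNode α k ^ 2) *
        (wilsonPoly (1 - a 0) (1 - a 1) (1 - a 2) (1 - a 3) n).eval (dougallNode α k ^ 2)) =
      recipGammaProd a (α + k) * (X * (P m * P n)).eval (α + k) := by
    intro k
    rw [dougallCoeff_eq_recipGammaProd, dougallNode_sq, eval_mul, eval_mul, eval_X, hPe, hPe]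
    ring
  refine ⟨?_, fun hmn => ?_⟩
  · refine (summable_congr hterm).mpr ?_
    refine summable_recipGammaProd_mul_eval a α _ ?_
    have hd : (X * (P m * P n)).natDegree ≤ 1 + (m * 2 + n * 2) := by
      refine natDegree_mul_le.trans (add_le_add natDegree_X_le (natDegree_mul_le.trans ?_))
      rw [hPd m hm, hPd n hn]
    have hd' : ((X * (P m * P n)).natDegree : ℝ) ≤ 1 + (m * 2 + n * 2) := by exact_mod_cast hd
    linarith [(Nat.cast_nonneg m : (0 : ℝ) ≤ m)]
  · have heven : ∀ k Y, (P k).eval (-Y) = (P k).eval Y := by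
      intro k Y; rw [hPe, hPe, neg_sq]
    obtain ⟨V, hVd, hV⟩ := exists_casoratian_factor (P m) (P n) (heven m) (heven n)
    have hop : ∀ k Y, wilsonOp (fun j => 1 - a j) (fun y => (P k).eval y) Y =
        2 * Y * (2 * Y + 1) * (2 * Y - 1) *
          (k * (k + (1 - a 0) + (1 - a 1) + (1 - a 2) + (1 - a 3) - 1)) * (P k).eval Y := by
      intro k Y
      simp only [hPe]
      exact wilsonOp_wilsonPoly (fun j => 1 - a j) k Y
    have hlag := lagrange_identity (fun j => 1 - a j) (P m) (P n) V _ _ (hop m) (hop n) hV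
    set U : ℂ[X] := (∏ k, (C (1 - a k) + X)) * V with hU
    have hUe : ∀ Y, U.eval Y = (∏ k, (1 - a k + Y)) * V.eval Y := by
      intro Y; simp only [hU, eval_mul, eval_prod, eval_add, eval_C, eval_X]
    -- Distinct indices force one to be at least 1. Summability of `R U`, with `deg U ≤ 4 + 2m +
    -- 2n`, needs `9 + 2m + 2n < 2A`; the left side is below `A + 6`.
    have hA : 7 < (a 0 + a 1 + a 2 + a 3).re := by
      rcases Nat.lt_or_gt_of_ne hmn with h | h
      · have : (1 : ℝ) ≤ n := by exact_mod_cast (show 1 ≤ n by omega)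
        linarith
      · have : (1 : ℝ) ≤ m := by exact_mod_cast (show 1 ≤ m by omega)
        linarith
    have hsum : Summable fun k : ℤ => recipGammaProd a (α + k) * U.eval (α + k) := by
      refine summable_recipGammaProd_mul_eval a α _ ?_
      have hd : U.natDegree ≤ 4 + (m * 2 + n * 2) := by
        rw [hPd m hm, hPd n hn] at hVd
        refine natDegree_mul_le.trans (add_le_add ?_ hVd)
        refine (natDegree_prod_le _ _).trans ?_
        refine (Finset.sum_le_card_nsmul _ _ 1 fun k _ => ?_).trans (by simp)
        rw [add_comm, natDegree_X_add_C]
      have hd' : (U.natDegree : ℝ) ≤ 4 + (m * 2 + n * 2) := by exact_mod_cast hd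
      linarith
    have hshift : HasSum (fun k : ℤ => recipGammaProd a (α + (k - 1 : ℤ)) *
        U.eval (α + (k - 1 : ℤ))) (∑' k : ℤ, recipGammaProd a (α + k) * U.eval (α + k)) :=
      (Equiv.hasSum_iff (Equiv.subRight (1 : ℤ))).mpr hsum.hasSum
    have hdiff := (hsum.hasSum.sub hshift).tsum_eq
    rw [sub_self] at hdiff
    set l : ℂ := ((m : ℂ) * (m + (1 - a 0) + (1 - a 1) + (1 - a 2) + (1 - a 3) - 1) -
      n * (n + (1 - a 0) + (1 - a 1) + (1 - a 2) + (1 - a 3) - 1)) with hl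
    -- The eigenvalue difference factors as `(m-n)(m+n+3-∑ a_j)`, and the second factor has negative
    -- real part.
    have hl0 : l ≠ 0 := by
      intro h0
      have hfac : ((m : ℂ) - n) * (m + n + 3 - (a 0 + a 1 + a 2 + a 3)) = 0 := by
        linear_combination h0
      rcases mul_eq_zero.mp hfac with h | h
      · exact hmn (by exact_mod_cast sub_eq_zero.mp h)
      · have h1 := congrArg Complex.re h
        simp at h1 hm hn
        linarith [(Nat.cast_nonneg m : (0 : ℝ) ≤ m), (Nat.cast_nonneg n : (0 : ℝ) ≤ n)]
    have hfinal : ∀ k : ℤ, recipGammaProd a (α + k) * U.eval (α + k) -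
        recipGammaProd a (α + (k - 1 : ℤ)) * U.eval (α + (k - 1 : ℤ)) =
        2 * l * (recipGammaProd a (α + k) * (X * (P m * P n)).eval (α + k)) := by
      intro k
      have h1 := hlag (α + k)
      have h2 := recipGammaProd_sub_one a (α + k)
      rw [hUe, hUe, show α + ((k - 1 : ℤ) : ℂ) = α + k - 1 by push_cast; ring, eval_mul, eval_mul,
        eval_X]
      linear_combination -recipGammaProd a (α + k) * h1 - V.eval (α + k - 1) * h2
    rw [tsum_congr hfinal, tsum_mul_left] at hdiff
    rw [dougallIntegral, tsum_congr hterm]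
    exact (mul_eq_zero.mp hdiff).resolve_left (mul_ne_zero two_ne_zero hl0)
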